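/- Let $\omega=\{0,1,2,\dots\}$. A multi-valued function $\mathcal F:\subseteq\omega^\omega\rightrightarrows\omega^\omega$ consists of a domain $\mathrm{dom}(\mathcal F)\subseteq\omega^\omega$ (its instances) and, for each $f\in\mathrm{dom}(\mathcal F)$, a nonempty set $\mathcal F(f)\subseteq\omega^\omega$ (the solutions to $f$). For multi-valued functions $\mathcal F,\mathcal G$, write $\mathcal F\leq_{\mathrm W}\mathcal G$ ($\mathcal F$ Weihrauch reduces to $\mathcal G$) if there are Turing functionals $\Phi,\Psi:\subseteq\omega^\omega\to\omega^\omega$ such that for every $f\in\mathrm{dom}(\mathcal F)$, $\Phi(f)$ is defined and belongs to $\mathrm{dom}(\mathcal G)$, and for every $g\in\mathcal G(\Phi(f))$, $\Psi(\langle f,g\rangle)$ is defined and belongs to $\mathcal F(f)$. Here $\langle f,g\rangle(2n)=f(n)$ and $\langle f,g\rangle(2n+1)=g(n)$. Sets of natural numbers are coded by their characteristic functions, and a linear order $(L,<_L)$ with $L\subseteq\omega$ is coded by $\langle\chi_L,\chi_{<_L}\rangle$, where $<_L\,\subseteq L\times L$ is viewed as a set of natural numbers via a standard computable pairing of natural numbers.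 Consider the following multi-valued functions. - $\mathsf{RT}^1_5$: an instance is a coloring $c:\omega\to\{0,1,2,3,4\}$; a solution is an infinite $H\subseteq\omega$ that is monochromatic for $c$, i.e. $c(x)=c(y)$ for all $x,y\in H$. - $\mathsf{RT}^1_{<\infty}$: an instance is a coloring $c:\omega\to\omega$ with finite range; a solution is an infinite $H\subseteq\omega$ that is monochromatic for $c$. - $\mathsf{ADS}$: an instance is an infinite linear order $(L,<_L)$ with $L\subseteq\omega$; a solution is an infinite $S\subseteq L$ that is either an ascending sequence (for all $x,y\in S$, $x<y$ implies $x<_L y$) or a descending sequence (for all $x,y\in S$, $x<y$ implies $y<_L x$). **Theorem.** $\mathsf{RT}^1_5\nleq_{\mathrm W}\mathsf{ADS}$. Therefore $\mathsf{RT}^1_{<\infty}\nleq_{\mathrm W}\mathsf{ADS}$. -/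

import Mathlib

/-! Turing functionals on Baire space `ℕ → ℕ`, multi-valued functions and Weihrauch reducibility,
the infinite pigeonhole principle and the ascending/descending sequence principle. -/

namespace Weihrauch

/-- Programs for partial recursive functions with an oracle. The constructors are those of
Mathlib's `Nat.RecursiveIn`, for a single oracle that is not part of the program. -/
inductive OracleCode : Type
  | zero : OracleCode
  | succ : OracleCode
  | left : OracleCode
  | right : OracleCode
  | oracle : OracleCode
  | pair : OracleCode → OracleCode → OracleCode
  | comp : OracleCode → OracleCode → OracleCode
  | prec : OracleCode → OracleCode → OracleCode
  | rfind : OracleCode → OracleCode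

/-- The partial function computed by a program with oracle `f`. -/
def OracleCode.eval (f : ℕ → ℕ) : OracleCode → ℕ → Part ℕ
  | .zero => fun _ => Part.some 0
  | .succ => fun n => Part.some (n + 1)
  | .left => fun n => Part.some n.unpair.1
  | .right => fun n => Part.some n.unpair.2
  | .oracle => fun n => Part.some (f n)
  | .pair a b => fun n => Nat.pair <$> a.eval f n <*> b.eval f n
  | .comp a b => fun n => b.eval f n >>= a.eval f
  | .prec a b => fun p =>
      p.unpair.2.rec (a.eval f p.unpair.1) fun y IH => do
        let i ← IH
        b.eval f (Nat.pair p.unpair.1 (Nat.pair y i))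
  | .rfind a => fun p =>
      Nat.rfind fun n => (fun m => decide (m = 0)) <$> a.eval f (Nat.pair p n)

/-- The programs with oracle `f` compute exactly the functions that are recursive in `f` in the
sense of Mathlib. -/
theorem OracleCode.exists_eval_eq_iff (f : ℕ → ℕ) (g : ℕ →. ℕ) :
    (∃ e : OracleCode, e.eval f = g) ↔ Nat.RecursiveIn {(f : ℕ →. ℕ)} g := by
  constructor
  · rintro ⟨e, rfl⟩
    induction e with
    | zero => exact Nat.RecursiveIn.zero
    | succ => exact Nat.RecursiveIn.succ
    | left => exact Nat.RecursiveIn.left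
    | right => exact Nat.RecursiveIn.right
    | oracle => exact Nat.RecursiveIn.oracle _ rfl
    | pair _ _ iha ihb => exact Nat.RecursiveIn.pair iha ihb
    | comp _ _ iha ihb => exact Nat.RecursiveIn.comp iha ihb
    | prec _ _ iha ihb => exact Nat.RecursiveIn.prec iha ihb
    | rfind _ iha => exact Nat.RecursiveIn.rfind iha
  · intro h
    induction h with
    | zero => exact ⟨.zero, rfl⟩
    | succ => exact ⟨.succ, rfl⟩
    | left => exact ⟨.left, rfl⟩
    | right => exact ⟨.right, rfl⟩
    | oracle g hg => exact ⟨.oracle, by rw [Set.mem_singleton_iff.mp hg]; rfl⟩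
    | pair _ _ iha ihb =>
      obtain ⟨a, rfl⟩ := iha
      obtain ⟨b, rfl⟩ := ihb
      exact ⟨.pair a b, rfl⟩
    | comp _ _ iha ihb =>
      obtain ⟨a, rfl⟩ := iha
      obtain ⟨b, rfl⟩ := ihb
      exact ⟨.comp a b, rfl⟩
    | prec _ _ iha ihb =>
      obtain ⟨a, rfl⟩ := iha
      obtain ⟨b, rfl⟩ := ihb
      exact ⟨.prec a b, rfl⟩
    | rfind _ iha =>
      obtain ⟨a, rfl⟩ := iha
      exact ⟨.rfind a, rfl⟩

/-- The partial map on Baire space given by a program: it is defined at `f` exactly when the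
program with oracle `f` halts on every input. -/
def OracleCode.functional (e : OracleCode) : (ℕ → ℕ) →. (ℕ → ℕ) :=
  fun f => ⟨∀ n, (e.eval f n).Dom, fun h n => (e.eval f n).get (h n)⟩

/-- `Φ : ⊆ ℕ^ℕ → ℕ^ℕ` is a Turing functional. -/
def IsTuringFunctional (Φ : (ℕ → ℕ) →. (ℕ → ℕ)) : Prop :=
  ∃ e : OracleCode, e.functional = Φ

/-- The pairing `⟨f, g⟩` with `⟨f, g⟩(2n) = f(n)` and `⟨f, g⟩(2n+1) = g(n)`. -/
def join (f g : ℕ → ℕ) : ℕ → ℕ :=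
  fun n => if n % 2 = 0 then f (n / 2) else g (n / 2)

/-- A multi-valued partial function from Baire space to itself: a domain (the instances), and for
every instance a nonempty set of values (its solutions). Values of `sol` outside `dom` are
irrelevant. -/
structure MultiFun where
  dom : Set (ℕ → ℕ)
  sol : (ℕ → ℕ) → Set (ℕ → ℕ)
  nonempty : ∀ f ∈ dom, (sol f).Nonempty

/-- Weihrauch reducibility: there are Turing functionals `Φ`, `Ψ` such that for every `f` in the
domain of `F`, `Φ(f)` is defined and in the domain of `G`, and for every `g ∈ G(Φ(f))`,
`Ψ(⟨f, g⟩)` is defined and in `F(f)`. -/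
def WeihrauchReducible (F G : MultiFun) : Prop :=
  ∃ Φ Ψ : (ℕ → ℕ) →. (ℕ → ℕ), IsTuringFunctional Φ ∧ IsTuringFunctional Ψ ∧
    ∀ f ∈ F.dom, ∃ h ∈ Φ f, h ∈ G.dom ∧
      ∀ g ∈ G.sol h, ∃ k ∈ Ψ (join f g), k ∈ F.sol f

/-- `f` is the characteristic function of a set. -/
def IsCharFun (f : ℕ → ℕ) : Prop := ∀ n, f n = 0 ∨ f n = 1

/-- The set with characteristic function `f`. -/
def toSet (f : ℕ → ℕ) : Set ℕ := {n | f n = 1}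

/-- The characteristic functions of the infinite sets that are monochromatic for `c`. -/
def monochromatic (c : ℕ → ℕ) : Set (ℕ → ℕ) :=
  {h | IsCharFun h ∧ (toSet h).Infinite ∧ ∀ x ∈ toSet h, ∀ y ∈ toSet h, c x = c y}

theorem exists_charFun (S : Set ℕ) : ∃ h, IsCharFun h ∧ toSet h = S := by
  classical
  refine ⟨fun n => if n ∈ S then 1 else 0, fun n => ?_, ?_⟩
  · by_cases hn : n ∈ S <;> simp [hn]
  · ext n
    simp [toSet]

theorem monochromatic_nonempty (c : ℕ → ℕ) (hc : (Set.range c).Finite) :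
    (monochromatic c).Nonempty := by
  obtain ⟨i, hi⟩ : ∃ i, (c ⁻¹' {i}).Infinite := by
    by_contra hcon
    have hfin : ∀ i, (c ⁻¹' {i}).Finite := fun i => Set.not_infinite.mp fun hi => hcon ⟨i, hi⟩
    have huniv := hc.preimage' fun i _ => hfin i
    rw [Set.preimage_range] at huniv
    exact Set.infinite_univ huniv
  obtain ⟨h, hh, hS⟩ := exists_charFun {n | c n = i}
  refine ⟨h, hh, by rw [hS]; exact hi, ?_⟩
  rw [hS]
  intro x hx y hy
  rw [Set.mem_ofPred_eq] at hx hy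
  rw [hx, hy]

/-- `RT¹_k`. Instances: colorings `c : ℕ → {0, …, k-1}`.
Solutions: infinite monochromatic sets. -/
def RT1 (k : ℕ) : MultiFun where
  dom := {c | ∀ n, c n < k}
  sol := monochromatic
  nonempty c hc := monochromatic_nonempty c
    ((Set.finite_Iio k).subset (Set.range_subset_iff.mpr hc))

/-- `RT¹_{<∞}`. Instances: colorings `c : ℕ → ℕ` with finite range.
Solutions: infinite monochromatic sets. -/
def RT1Fin : MultiFun where
  dom := {c | (Set.range c).Finite}
  sol := monochromatic
  nonempty := monochromatic_nonempty

/-- A linear order `(L, <_L)` with `L ⊆ ℕ` is coded by `⟨f₀, f₁⟩` with `f₀` the characteristic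
function of `L`, and `f₁` that of the set of codes of pairs `(x, y)` with `x <_L y`. This is `L`. -/
def carrier (f : ℕ → ℕ) : Set ℕ := {x | f (2 * x) = 1}

/-- The strict order relation `<_L` coded by `f`. -/
def lt (f : ℕ → ℕ) (x y : ℕ) : Prop := f (2 * Nat.pair x y + 1) = 1

/-- `f` codes a linear order on a subset of `ℕ`. -/
structure IsLinearOrderCode (f : ℕ → ℕ) : Prop where
  isCharFun : IsCharFun f
  mem_of_lt : ∀ x y, lt f x y → x ∈ carrier f ∧ y ∈ carrier f
  irrefl : ∀ x, ¬ lt f x x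
  trans : ∀ x y z, lt f x y → lt f y z → lt f x z
  total : ∀ x ∈ carrier f, ∀ y ∈ carrier f, x ≠ y → lt f x y ∨ lt f y x

/-- `S` is an ascending sequence in the order coded by `f`. -/
def IsAscending (f : ℕ → ℕ) (S : Set ℕ) : Prop :=
  S ⊆ carrier f ∧ ∀ x ∈ S, ∀ y ∈ S, x < y → lt f x y

/-- `S` is a descending sequence in the order coded by `f`. -/
def IsDescending (f : ℕ → ℕ) (S : Set ℕ) : Prop :=
  S ⊆ carrier f ∧ ∀ x ∈ S, ∀ y ∈ S, x < y → lt f y x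

theorem exists_ascending_or_descending (f : ℕ → ℕ) (hf : IsLinearOrderCode f)
    (hL : (carrier f).Infinite) :
    ∃ S : Set ℕ, S.Infinite ∧ (IsAscending f S ∨ IsDescending f S) := by
  classical
  let u : ℕ → ℕ := Nat.nth (· ∈ carrier f)
  have hu : StrictMono u := Nat.nth_strictMono hL
  have hmem : ∀ n, u n ∈ carrier f := fun n => Nat.nth_mem_of_infinite hL n
  have : IsTrans ℕ (lt f) := ⟨hf.trans⟩
  obtain ⟨g, hg⟩ := exists_increasing_or_nonincreasing_subseq (lt f) u
  have hug : StrictMono fun n => u (g n) := hu.comp g.strictMono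
  refine ⟨Set.range fun n => u (g n), Set.infinite_range_of_injective hug.injective, ?_⟩
  have hsub : (Set.range fun n => u (g n)) ⊆ carrier f := by
    rintro _ ⟨n, rfl⟩
    exact hmem _
  rcases hg with hg | hg
  · left
    refine ⟨hsub, ?_⟩
    rintro _ ⟨m, rfl⟩ _ ⟨n, rfl⟩ hlt
    exact hg m n (hug.lt_iff_lt.mp hlt)
  · right
    refine ⟨hsub, ?_⟩
    rintro _ ⟨m, rfl⟩ _ ⟨n, rfl⟩ hlt
    exact (hf.total _ (hmem _) _ (hmem _) (ne_of_lt hlt)).resolve_left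
      (hg m n (hug.lt_iff_lt.mp hlt))

/-- `ADS`. Instances: infinite linear orders `(L, <_L)` with `L ⊆ ℕ`. Solutions: infinite sets
`S ⊆ L` that are ascending sequences in `L` or descending sequences in `L`. -/
def ADS : MultiFun where
  dom := {f | IsLinearOrderCode f ∧ (carrier f).Infinite}
  sol f := {h | IsCharFun h ∧ (toSet h).Infinite ∧
    (IsAscending f (toSet h) ∨ IsDescending f (toSet h))}
  nonempty := by
    rintro f ⟨hf, hL⟩
    obtain ⟨S, hS, hSf⟩ := exists_ascending_or_descending f hf hL
    obtain ⟨h, hh, rfl⟩ := exists_charFun S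
    exact ⟨h, hh, hS, hSf⟩

end Weihrauch

/-! Only continuity matters: a Turing functional reads finitely much of its oracle, so a reduction
assigns orders to colorings continuously, and a finite part of a monotone sequence already commits
to a color. If later values make that color occur only finitely often, no infinite monotone sequence
may continue the finite part: its last element blocks the color in that direction (`exists_blocks`).

Continuing a coloring by a constant produces a new blocker of that constant, which must lie below,
in its own direction `t`, all earlier `t`-blockers of other colors (`exists_blocks_extension`).
Cycling through three colors, two of them share a direction `t` infinitely often, which gives an
infinite `t`-decreasing sequence of `t`-blockers (`exists_decreasing_blocks`). Being monotone
itself, this sequence has an element that also blocks some color in the opposite direction. Thus two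
blockers in opposite directions cost at most two colors; a second run with three others, hence five
in all, produces a sequence that violates one of them (`false_of_five_colors`). -/

namespace Weihrauch

/-! ### Finite use of oracle computations -/

section Continuity

/-- A halting oracle computation uses only finitely many values of its oracle. -/
theorem OracleCode.exists_use (e : OracleCode) (f : ℕ → ℕ) (n v : ℕ) (h : v ∈ e.eval f n) :
    ∃ m, ∀ f' : ℕ → ℕ, (∀ j < m, f' j = f j) → v ∈ e.eval f' n := by
  induction e generalizing n v with
  | zero => exact ⟨0, fun f' _ => h⟩
  | succ => exact ⟨0, fun f' _ => h⟩
  | left => exact ⟨0, fun f' _ => h⟩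
  | right => exact ⟨0, fun f' _ => h⟩
  | oracle =>
    refine ⟨n + 1, fun f' hf' => ?_⟩
    simp only [OracleCode.eval, Part.mem_some_iff] at h ⊢
    rw [h, hf' n n.lt_succ_self]
  | pair a b iha ihb =>
    simp only [OracleCode.eval, Seq.seq, Part.map_eq_map, Part.mem_bind_iff,
      Part.mem_map_iff] at h ⊢
    obtain ⟨_, ⟨x, hx, rfl⟩, y, hy, rfl⟩ := h
    obtain ⟨m₁, h₁⟩ := iha n x hx
    obtain ⟨m₂, h₂⟩ := ihb n y hy
    exact ⟨max m₁ m₂, fun f' hf' =>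
      ⟨_, ⟨x, h₁ f' fun j hj => hf' j (lt_max_of_lt_left hj), rfl⟩, y,
        h₂ f' fun j hj => hf' j (lt_max_of_lt_right hj), rfl⟩⟩
  | comp a b iha ihb =>
    simp only [OracleCode.eval, Part.bind_eq_bind, Part.mem_bind_iff] at h ⊢
    obtain ⟨x, hx, hv⟩ := h
    obtain ⟨m₁, h₁⟩ := ihb n x hx
    obtain ⟨m₂, h₂⟩ := iha x v hv
    exact ⟨max m₁ m₂, fun f' hf' =>
      ⟨x, h₁ f' fun j hj => hf' j (lt_max_of_lt_left hj),
        h₂ f' fun j hj => hf' j (lt_max_of_lt_right hj)⟩⟩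
  | prec a b iha ihb =>
    simp only [OracleCode.eval] at h ⊢
    generalize n.unpair.1 = p at h ⊢
    generalize n.unpair.2 = q at h ⊢
    induction q generalizing v with
    | zero => exact iha p v h
    | succ q ih =>
      simp only [Part.bind_eq_bind, Part.mem_bind_iff] at h ⊢
      obtain ⟨x, hx, hv⟩ := h
      obtain ⟨m₁, h₁⟩ := ih x hx
      obtain ⟨m₂, h₂⟩ := ihb _ v hv
      exact ⟨max m₁ m₂, fun f' hf' =>
        ⟨x, h₁ f' fun j hj => hf' j (lt_max_of_lt_left hj),
          h₂ f' fun j hj => hf' j (lt_max_of_lt_right hj)⟩⟩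
  | rfind a iha =>
    refine (exists_congr fun m => forall₂_congr fun f' _ => Nat.mem_rfind).mpr ?_
    replace h := Nat.mem_rfind.mp h
    simp only [Part.map_eq_map, Part.mem_map_iff] at h ⊢
    obtain ⟨⟨x, hx, hx0⟩, hlt⟩ := h
    obtain ⟨m₁, h₁⟩ := iha _ x hx
    -- The bound is chosen even when `k < v` fails, so that `choose` gives a total `g`; its supremum
    -- over the failed trials `k < v` bounds their uses.
    have key : ∀ k, ∃ m, k < v → ∀ f' : ℕ → ℕ, (∀ j < m, f' j = f j) →
        ∃ y ∈ a.eval f' (Nat.pair n k), decide (y = 0) = false := by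
      intro k
      by_cases hk : k < v
      · obtain ⟨y, hy, hy0⟩ := hlt hk
        obtain ⟨m, hm⟩ := iha _ y hy
        exact ⟨m, fun _ f' hf' => ⟨y, hm f' hf', hy0⟩⟩
      · exact ⟨0, fun h => absurd h hk⟩
    choose g hg using key
    refine ⟨max m₁ ((Finset.range v).sup g), fun f' hf' =>
      ⟨⟨x, h₁ f' fun j hj => hf' j (lt_max_of_lt_left hj), hx0⟩, fun {k} hk => ?_⟩⟩
    exact hg k hk f' fun j hj => hf' j (lt_max_of_lt_right
      (hj.trans_le (Finset.le_sup (Finset.mem_range.mpr hk))))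

theorem OracleCode.functional_use (e : OracleCode) {f h : ℕ → ℕ} (hf : h ∈ e.functional f)
    (n : ℕ) : ∃ m, ∀ f' h' : ℕ → ℕ, (∀ j < m, f' j = f j) → h' ∈ e.functional f' → h' n = h n := by
  obtain ⟨hd, rfl⟩ := hf
  obtain ⟨m, hm⟩ := e.exists_use f n _ (Part.get_mem (hd n))
  refine ⟨m, fun f' h' hf' hh' => ?_⟩
  obtain ⟨hd', rfl⟩ := hh'
  exact Part.get_eq_of_mem (hm f' hf') _

theorem join_congr {m : ℕ} {f f' g g' : ℕ → ℕ} (hf : ∀ j < m, f' j = f j)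
    (hg : ∀ j < m, g' j = g j) : ∀ j < m, join f' g' j = join f g j := by
  intro j hj
  have : j / 2 < m := (Nat.div_le_self j 2).trans_lt hj
  simp only [join, hf _ this, hg _ this]

end Continuity

/-! ### Continuous reductions in the abstract -/

/-- The relation `r` or its converse. -/
def dir (r : ℕ → ℕ → Prop) : Bool → ℕ → ℕ → Prop
  | true => r
  | false => fun x y => r y x

theorem dir_not {r : ℕ → ℕ → Prop} {t : Bool} {x y : ℕ} : dir r (!t) x y ↔ dir r t y x := by
  cases t <;> rfl

/-- `S`, listed in the order of `ℕ`, is increasing for `r`. -/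
def Increasing (r : ℕ → ℕ → Prop) (S : Set ℕ) : Prop :=
  ∀ x ∈ S, ∀ y ∈ S, x < y → r x y

/-- The colorings `c'` and `c` agree below `m`. -/
def Agree {K : Type*} (m : ℕ) (c' c : ℕ → K) : Prop := ∀ n < m, c' n = c n

theorem Agree.mono {K : Type*} {m n : ℕ} {c' c : ℕ → K} (h : Agree n c' c) (hmn : m ≤ n) :
    Agree m c' c := fun j hj => h j (hj.trans_le hmn)

theorem Agree.trans {K : Type*} {m : ℕ} {c₁ c₂ c₃ : ℕ → K} (h : Agree m c₁ c₂)
    (h' : Agree m c₂ c₃) : Agree m c₁ c₃ := fun j hj => (h j hj).trans (h' j hj)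

/-- A continuous assignment of linear orders `(M c, r c)` to colorings `c`, such that an infinite
increasing or decreasing sequence continuously determines a color that occurs infinitely often. -/
structure ContinuousReduction {K : Type*} (M : (ℕ → K) → Set ℕ) (r : (ℕ → K) → ℕ → ℕ → Prop) :
    Prop where
  mem_of_lt : ∀ c x y, r c x y → x ∈ M c ∧ y ∈ M c
  trans : ∀ c x y z, r c x y → r c y z → r c x z
  total : ∀ c, ∀ x ∈ M c, ∀ y ∈ M c, x ≠ y → r c x y ∨ r c y x
  exists_increasing : ∀ c, ∃ S : Set ℕ, S.Infinite ∧ ∃ t, Increasing (dir (r c) t) S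
  mem_use : ∀ c x, ∃ m, ∀ c', Agree m c' c → (x ∈ M c' ↔ x ∈ M c)
  lt_use : ∀ c x y, ∃ m, ∀ c', Agree m c' c → (r c' x y ↔ r c x y)
  answer : ∀ c S t, S.Infinite → Increasing (dir (r c) t) S → ∃ i m, ∀ c' S' t', Agree m c' c →
    (∀ x < m, x ∈ S' ↔ x ∈ S) → S'.Infinite → Increasing (dir (r c') t') S' →
    {n | c' n = i}.Infinite

/-! ### Blocking elements -/

namespace ContinuousReduction

variable {K : Type*} {M : (ℕ → K) → Set ℕ} {r : (ℕ → K) → ℕ → ℕ → Prop}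

/-- The first `m` values of `c` guarantee that `y` is in the order, and that if the color `i` occurs
only finitely often, then there are no infinite `t`-increasing sequences `t`-above `y`. -/
def Blocks (M : (ℕ → K) → Set ℕ) (r : (ℕ → K) → ℕ → ℕ → Prop) (t : Bool) (m : ℕ) (c : ℕ → K)
    (y : ℕ) (i : K) : Prop :=
  ∀ c', Agree m c' c → y ∈ M c' ∧ ({n | c' n = i}.Finite → ∀ T : Set ℕ, T.Infinite →
    Increasing (dir (r c') t) T → ¬ ∀ x ∈ T, dir (r c') t y x)

theorem Blocks.of_agree {t : Bool} {m n : ℕ} {c c' : ℕ → K} {y : ℕ} {i : K}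
    (h : Blocks M r t m c y i) (hmn : m ≤ n) (hc : Agree m c' c) : Blocks M r t n c' y i :=
  fun c'' hc'' => h c'' ((hc''.mono hmn).trans hc)

theorem dir_trans (H : ContinuousReduction M r) {c : ℕ → K} {t : Bool} {x y z : ℕ}
    (h : dir (r c) t x y) (h' : dir (r c) t y z) : dir (r c) t x z := by
  cases t
  · exact H.trans c _ _ _ h' h
  · exact H.trans c _ _ _ h h'

theorem dir_mem (H : ContinuousReduction M r) {c : ℕ → K} {t : Bool} {x y : ℕ}
    (h : dir (r c) t x y) : x ∈ M c ∧ y ∈ M c := by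
  cases t
  · exact (H.mem_of_lt c _ _ h).symm
  · exact H.mem_of_lt c _ _ h

theorem dir_total (H : ContinuousReduction M r) {c : ℕ → K} (t : Bool) {x y : ℕ}
    (hx : x ∈ M c) (hy : y ∈ M c) (hxy : x ≠ y) : dir (r c) t x y ∨ dir (r c) t y x := by
  cases t
  · exact (H.total c _ hx _ hy hxy).symm
  · exact H.total c _ hx _ hy hxy

theorem exists_lt_use (H : ContinuousReduction M r) (c : ℕ → K) (k : ℕ) :
    ∃ m, ∀ c', Agree m c' c → ∀ x < k, ∀ y < k, ∀ t, dir (r c') t x y ↔ dir (r c) t x y := by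
  choose g hg using H.lt_use c
  refine ⟨(Finset.range k ×ˢ Finset.range k).sup fun p => g p.1 p.2, fun c' hc' x hx y hy t => ?_⟩
  have key : ∀ x < k, ∀ y < k, (r c' x y ↔ r c x y) := fun x hx y hy =>
    hg x y c' (hc'.mono (Finset.le_sup (f := fun p : ℕ × ℕ => g p.1 p.2) (b := (x, y))
      (by simp [hx, hy])))
  cases t
  · exact key y hy x hx
  · exact key x hx y hy

/-- The color answered for `S` depends only on `S` and `c` below some bound. Past that bound, any
infinite sequence above `y` could be spliced onto `S` without changing the answer. -/
theorem exists_blocks (H : ContinuousReduction M r) {c : ℕ → K} {S : Set ℕ} {t : Bool}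
    (hS : S.Infinite) (hinc : Increasing (dir (r c) t) S) (k : ℕ) :
    ∃ y ∈ S, k ≤ y ∧ ∃ i m, {n | c n = i}.Infinite ∧ Blocks M r t m c y i := by
  obtain ⟨i, m₀, hi⟩ := H.answer c S t hS hinc
  obtain ⟨y, hyS, hy⟩ := hS.exists_gt (max k m₀)
  obtain ⟨m₁, h₁⟩ := H.exists_lt_use c (y + 1)
  obtain ⟨m₂, h₂⟩ := H.mem_use c y
  have hyM : y ∈ M c := by
    obtain ⟨z, hz, hyz⟩ := hS.exists_gt y
    exact (H.dir_mem (hinc y hyS z hz hyz)).1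
  refine ⟨y, hyS, (le_max_left _ _).trans hy.le, i, max m₀ (max m₁ m₂),
    hi c S t (fun _ _ => rfl) (fun _ _ => Iff.rfl) hS hinc, fun c' hc' => ⟨?_, ?_⟩⟩
  · exact (h₂ c' (hc'.mono (by simp))).mpr hyM
  intro hfin T hT hTinc hyT
  have hlt := h₁ c' (hc'.mono (by simp))
  -- Since `m₀ < y`, the splice of `S` up to `y` with `T` beyond `y` agrees with `S` below `m₀`.
  refine hi c' ({x ∈ S | x ≤ y} ∪ {x ∈ T | y < x}) t (hc'.mono (by simp)) ?_ ?_ ?_ hfin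
  · intro x hx
    have hxy : x < y := (hx.trans_le (le_max_right _ _)).trans hy
    simp [hxy.le, hxy.not_gt]
  · refine Set.Infinite.mono Set.subset_union_right ?_
    refine (hT.sdiff (Set.finite_Iic y)).mono fun x hx => ⟨hx.1, ?_⟩
    simpa using hx.2
  · have hF : ∀ x ∈ S, ∀ x' ∈ S, x' ≤ y → x < x' → dir (r c') t x x' := fun x hx x' hx' hy' hxx' =>
      (hlt x (by omega) x' (by omega) t).mpr (hinc x hx x' hx' hxx')
    rintro x (⟨hx, hxy⟩ | ⟨hx, hxy⟩) x' (⟨hx', hxy'⟩ | ⟨hx', hxy'⟩) hxx'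
    · exact hF x hx x' hx' hxy' hxx'
    · rcases hxy.eq_or_lt with rfl | hxy
      · exact hyT x' hx'
      · exact H.dir_trans (hF x hx y hyS le_rfl hxy) (hyT x' hx')
    · omega
    · exact hTinc x hx x' hx' hxx'

/-- After `n` only `b` recurs, so a monotone sequence `S` for the extension can only answer `b`. An
earlier `t`-blocker `w` of another color cannot be `t`-below `y ∈ S`, or the tail of `S` would be a
forbidden sequence above `w`. -/
theorem exists_blocks_extension (H : ContinuousReduction M r) (c : ℕ → K) (n k : ℕ) (b : K) :
    ∃ (c' : ℕ → K) (n' y : ℕ) (t : Bool), Agree n c' c ∧ (∀ j, n ≤ j → c' j = b) ∧ n < n' ∧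
      k ≤ y ∧ Blocks M r t n' c' y b ∧
      ∀ c'', Agree n' c'' c' → ∀ w < k, ∀ i ≠ b, Blocks M r t n c w i → dir (r c'') t y w := by
  let c' : ℕ → K := fun j => if j < n then c j else b
  have hagree : Agree n c' c := fun j hj => by simp [c', hj]
  have hb : ∀ j, n ≤ j → c' j = b := fun j hj => by simp [c', hj.not_gt]
  have hfin : ∀ i ≠ b, {j | c' j = i}.Finite := fun i hi =>
    (Set.finite_Iio n).subset fun j hj => by
      by_contra hjn
      exact hi (hj.symm.trans (hb j (not_lt.mp hjn)))
  obtain ⟨S, hS, t, hinc⟩ := H.exists_increasing c'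
  obtain ⟨y, hyS, hky, i, m, hi, hblock⟩ := H.exists_blocks hS hinc k
  obtain rfl : i = b := by
    by_contra hne
    exact hi (hfin i hne)
  obtain ⟨m', hm'⟩ := H.exists_lt_use c' (y + 1)
  refine ⟨c', max (n + 1) (max m m'), y, t, hagree, hb, by simp, hky,
    hblock.of_agree (by simp) fun _ _ => rfl, fun c'' hc'' w hw i' hi' hwb => ?_⟩
  refine (hm' c'' (hc''.mono (by simp)) y (by omega) w (by omega) t).mpr ?_
  obtain ⟨hwM, hwT⟩ := hwb c' hagree
  obtain ⟨x, hx, hyx⟩ := hS.exists_gt y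
  refine (H.dir_total t hwM (H.dir_mem (hinc y hyS x hx hyx)).1 (by omega)).resolve_left
    fun hwy => ?_
  refine hwT (hfin i' hi') {x ∈ S | y < x} ?_ (fun x hx x' hx' => hinc x hx.1 x' hx'.1)
    fun x hx => H.dir_trans hwy (hinc y hyS x hx.1 hx.2)
  refine (hS.sdiff (Set.finite_Iic y)).mono fun x hx => ⟨hx.1, ?_⟩
  simpa using hx.2

/-- Iterating over a sequence of colors `b`. -/
theorem exists_blocks_sequence (H : ContinuousReduction M r) (c₀ : ℕ → K) (n₀ k₀ : ℕ)
    (b : ℕ → K) :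
    ∃ (c : ℕ → K) (n y : ℕ → ℕ) (t : ℕ → Bool), Agree n₀ c c₀ ∧
      (∀ j, n₀ ≤ j → ∃ s, c j = b s) ∧ StrictMono y ∧
      (∀ s, Blocks M r (t s) (n s) c (y s) (b s)) ∧
      (∀ s, ∀ w < k₀, ∀ i ≠ b s, Blocks M r (t s) n₀ c₀ w i → dir (r c) (t s) (y s) w) ∧
      ∀ s s', s < s' → t s = t s' → b s ≠ b s' → dir (r c) (t s') (y s') (y s) := by
  choose C N Y T hagree hb hN hY hblock hlt using H.exists_blocks_extension
  -- A stage holds the current coloring, the length already fixed, and a strict bound on the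
  -- blockers found so far.
  let st : ℕ → (ℕ → K) × ℕ × ℕ := fun s => s.rec (c₀, n₀, k₀) fun s p =>
    (C p.1 p.2.1 p.2.2 (b s), N p.1 p.2.1 p.2.2 (b s), Y p.1 p.2.1 p.2.2 (b s) + 1)
  let d : ℕ → ℕ → K := fun s => (st s).1
  let n : ℕ → ℕ := fun s => (st s).2.1
  let k : ℕ → ℕ := fun s => (st s).2.2
  let y : ℕ → ℕ := fun s => Y (d s) (n s) (k s) (b s)
  let t : ℕ → Bool := fun s => T (d s) (n s) (k s) (b s)
  have hn : StrictMono n := strictMono_nat_of_lt_succ fun s => hN (d s) (n s) (k s) (b s)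
  have hyk : ∀ s, k s ≤ y s := fun s => hY (d s) (n s) (k s) (b s)
  have hk : StrictMono k := strictMono_nat_of_lt_succ fun s => Nat.lt_succ_of_le (hyk s)
  have hy : StrictMono y := strictMono_nat_of_lt_succ fun s =>
    (Nat.lt_succ_self (y s)).trans_le (hyk (s + 1))
  have hd : ∀ s s', s ≤ s' → Agree (n s) (d s') (d s) := by
    intro s s' hs
    induction s', hs using Nat.le_induction with
    | base => exact fun _ _ => rfl
    | succ s' hs ih =>
      exact Agree.trans (((hagree (d s') (n s') (k s') (b s')).mono (hn.monotone hs))) ih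
  -- Stage `j + 1` has fixed the value at `j`, because `j + 1 ≤ n (j + 1)`.
  let c : ℕ → K := fun j => d (j + 1) j
  have hc : ∀ s, Agree (n s) c (d s) := by
    intro s j hj
    rcases le_total s (j + 1) with h | h
    · exact hd _ _ h j hj
    · exact (hd _ _ h j (Nat.lt_of_succ_le hn.le_apply)).symm
  have hB : ∀ s, Blocks M r (t s) (n (s + 1)) c (y s) (b s) := fun s =>
    (hblock (d s) (n s) (k s) (b s)).of_agree le_rfl (hc (s + 1))
  have hL : ∀ s, ∀ w < k s, ∀ i ≠ b s, Blocks M r (t s) (n s) (d s) w i →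
      dir (r c) (t s) (y s) w := fun s => hlt (d s) (n s) (k s) (b s) c (hc (s + 1))
  refine ⟨c, fun s => n (s + 1), y, t, hc 0, ?_, hy, hB, ?_, ?_⟩
  · intro j hj
    have key : ∀ s, n 0 ≤ j → j < n s → ∃ s', d s j = b s' := by
      intro s hj
      induction s with
      | zero => intro h; omega
      | succ s ih =>
        intro h
        by_cases hjs : j < n s
        · obtain ⟨s', hs'⟩ := ih hjs
          exact ⟨s', (hd s (s + 1) s.le_succ j hjs).trans hs'⟩
        · exact ⟨s, hb (d s) (n s) (k s) (b s) j (not_lt.mp hjs)⟩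
    exact key (j + 1) hj (Nat.lt_of_succ_le hn.le_apply)
  · intro s w hw i hi hwb
    exact hL s w (hw.trans_le (hk.monotone s.zero_le)) i hi
      (hwb.of_agree (hn.monotone s.zero_le) (hd 0 s s.zero_le))
  · intro s s' hs ht hbs
    refine hL s' (y s) ((Nat.lt_succ_self (y s)).trans_le (hk.monotone hs)) (b s) hbs ?_
    rw [← ht]
    exact (hB s).of_agree (hn.monotone hs)
      fun j hj => (hc s' j (hj.trans_le (hn.monotone hs))).symm

/-- Cycling through three colors. -/
theorem exists_decreasing_blocks (H : ContinuousReduction M r) (c₀ : ℕ → K) (n₀ k₀ : ℕ)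
    (a : Fin 3 → K) (ha : Function.Injective a) :
    ∃ (c : ℕ → K) (t : Bool) (u : ℕ → ℕ), Agree n₀ c c₀ ∧
      (∀ j, n₀ ≤ j → c j ∈ Set.range a) ∧ StrictMono u ∧
      Increasing (dir (r c) (!t)) (Set.range u) ∧
      (∀ j, ∃ m, ∃ i ∈ Set.range a, Blocks M r t m c (u j) i) ∧
      ∀ j, ∀ w < k₀, ∀ i ∉ Set.range a, Blocks M r t n₀ c₀ w i → dir (r c) t (u j) w := by
  obtain ⟨c, n, y, t, hc, hcb, hy, hB, hw, hlt⟩ :=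
    H.exists_blocks_sequence c₀ n₀ k₀ fun s => a (Fin.ofNat 3 s)
  have hfreq : ∀ l : Fin 3, ∃ T, ∀ s, ∃ s' > s, t s' = T ∧ Fin.ofNat 3 s' = l := by
    intro l
    by_contra! hcon
    obtain ⟨s₁, h₁⟩ := hcon true
    obtain ⟨s₂, h₂⟩ := hcon false
    have hl : Fin.ofNat 3 (3 * (max s₁ s₂ + 1) + l) = l := by
      ext
      simp [Fin.ofNat, Nat.mod_eq_of_lt l.2]
    have hs₁ := le_max_left s₁ s₂
    have hs₂ := le_max_right s₁ s₂
    cases ht : t (3 * (max s₁ s₂ + 1) + l)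
    · exact h₂ _ (by omega) ht hl
    · exact h₁ _ (by omega) ht hl
  choose T hT using hfreq
  obtain ⟨l, l', hne, hll⟩ : ∃ l l' : Fin 3, l ≠ l' ∧ T l = T l' := by
    obtain ⟨l, l', h⟩ := Fintype.exists_ne_map_eq_of_card_lt T (by simp)
    exact ⟨l, l', h⟩
  -- From color `l` move to `l'`, from any other color to `l`: consecutive blockers then have
  -- different colors, and transitivity does the rest.
  have hnext : ∀ s, ∃ s' > s, t s' = T l ∧ Fin.ofNat 3 s' ≠ Fin.ofNat 3 s := by
    intro s
    by_cases hs : Fin.ofNat 3 s = l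
    · obtain ⟨s', h, h', h''⟩ := hT l' s
      exact ⟨s', h, h'.trans hll.symm, by rw [h'', hs]; exact hne.symm⟩
    · obtain ⟨s', h, h', h''⟩ := hT l s
      exact ⟨s', h, h', by rw [h'']; exact Ne.symm hs⟩
  choose f hf hft hfa using hnext
  -- Index `0` is skipped, as its direction need not be `T l`.
  let q : ℕ → ℕ := fun j => f^[j + 1] 0
  have hq : ∀ j, q (j + 1) = f (q j) := fun j => Function.iterate_succ_apply' f (j + 1) 0
  have hqt : ∀ j, t (q j) = T l := fun j => by
    simp only [q, Function.iterate_succ_apply']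
    exact hft _
  have hqm : StrictMono q := strictMono_nat_of_lt_succ fun j => by rw [hq]; exact hf _
  have hstep : ∀ j, dir (r c) (T l) (y (q (j + 1))) (y (q j)) := by
    intro j
    rw [← hqt (j + 1)]
    refine hlt _ _ (hqm j.lt_succ_self) ((hqt j).trans (hqt (j + 1)).symm) fun h => ?_
    exact hfa (q j) (by rw [← hq]; exact (ha h).symm)
  have hdec : ∀ j j', j < j' → dir (r c) (T l) (y (q j')) (y (q j)) := by
    intro j j' hj
    induction j', hj using Nat.le_induction with
    | base => exact hstep j
    | succ j' _ ih => exact H.dir_trans (hstep j') ih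
  refine ⟨c, T l, fun j => y (q j), hc, fun j hj => ?_, hy.comp hqm, ?_, fun j => ?_, ?_⟩
  · obtain ⟨s, hs⟩ := hcb j hj
    exact ⟨_, hs.symm⟩
  · rintro _ ⟨j, rfl⟩ _ ⟨j', rfl⟩ hjj
    exact dir_not.mpr (hdec j j' ((hy.comp hqm).lt_iff_lt.mp hjj))
  · exact ⟨_, _, ⟨_, rfl⟩, hqt j ▸ hB (q j)⟩
  · intro j w hwk i hi hwb
    rw [← hqt j] at hwb ⊢
    exact hw (q j) w hwk i (fun h => hi ⟨_, h.symm⟩) hwb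

/-! ### The contradiction with five colors -/

theorem finite_color {c : ℕ → K} {n : ℕ} {a : Fin 3 → K}
    (hc : ∀ j, n ≤ j → c j ∈ Set.range a) {i : K} (hi : i ∉ Set.range a) :
    {j | c j = i}.Finite :=
  (Set.finite_Iio n).subset fun j hj => by
    by_contra hjn
    exact hi (hj ▸ hc j (not_lt.mp hjn))

theorem exists_three_colors (i i' : Fin 5) :
    ∃ a : Fin 3 → Fin 5, Function.Injective a ∧ i ∉ Set.range a ∧ i' ∉ Set.range a := by
  have hcard : 3 ≤ ({i, i'}ᶜ : Finset (Fin 5)).card := by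
    rw [Finset.card_compl, Fintype.card_fin]
    have := Finset.card_le_two (a := i) (b := i')
    omega
  obtain ⟨s, hs, hs3⟩ := Finset.exists_subset_card_eq hcard
  refine ⟨s.orderEmbOfFin hs3, (s.orderEmbOfFin hs3).injective, ?_, ?_⟩ <;>
  · rw [Finset.range_orderEmbOfFin]
    intro h
    simpa using hs h

theorem false_of_five_colors {M : (ℕ → Fin 5) → Set ℕ} {r : (ℕ → Fin 5) → ℕ → ℕ → Prop}
    (H : ContinuousReduction M r) : False := by
  obtain ⟨a, ha, -, -⟩ := exists_three_colors 0 0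
  obtain ⟨c, t, u, -, -, hu, hinc, hB, -⟩ := H.exists_decreasing_blocks (fun _ => 0) 0 0 a ha
  obtain ⟨z, ⟨j, rfl⟩, -, i, m, -, hz⟩ :=
    H.exists_blocks (Set.infinite_range_of_injective hu.injective) hinc 0
  obtain ⟨m', i', -, hy⟩ := hB (j + 1)
  have hyz := hinc _ ⟨j, rfl⟩ _ ⟨j + 1, rfl⟩ (hu (Nat.lt_add_one j))
  obtain ⟨m'', hm''⟩ := H.exists_lt_use c (u (j + 1) + 1)
  have hjj := hu (Nat.lt_add_one j)
  -- `u j` blocks `i` in direction `!t` and `u (j + 1)` blocks `i'` in direction `t`. The next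
  -- extension starves both colors.
  obtain ⟨a', ha', hi, hi'⟩ := exists_three_colors i i'
  obtain ⟨c', t', v, hc', hcol, hv, hvinc, -, hlow⟩ := H.exists_decreasing_blocks c
    (max m (max m' m'')) (u (j + 1) + 1) a' ha'
  have hvinf := Set.infinite_range_of_injective hv.injective
  replace hyz := (hm'' c' (hc'.mono (by simp)) _ (by omega) _ (by omega) _).mpr hyz
  have hz' := (hz c' (hc'.mono (by simp))).2 (finite_color hcol hi)
  have hy' := (hy c' (hc'.mono (by simp))).2 (finite_color hcol hi')
  -- The sequence `v` lies `t'`-below the blocker of direction `t'`, hence `t'`-below the other one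
  -- too. As `v` is `!t'`-increasing, it is forbidden by that other blocker.
  by_cases ht : t' = t
  · subst ht
    refine hz' _ hvinf hvinc ?_
    rintro _ ⟨l, rfl⟩
    exact H.dir_trans hyz (dir_not.mpr (hlow l _ (by omega) i' hi'
      (hy.of_agree (by simp) fun _ _ => rfl)))
  · obtain rfl : t' = !t := by cases t <;> cases t' <;> simp_all
    rw [Bool.not_not] at hvinc
    refine hy' _ hvinf hvinc ?_
    rintro _ ⟨l, rfl⟩
    exact H.dir_trans (dir_not.mp hyz) (dir_not.mp (hlow l _ (by omega) i hi
      (hz.of_agree (by simp) fun _ _ => rfl)))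

end ContinuousReduction

/-! ### From Weihrauch reductions to continuous reductions -/

theorem mem_carrier_of_increasing {f : ℕ → ℕ} (hf : IsLinearOrderCode f) {S : Set ℕ}
    (hS : S.Infinite) {t : Bool} (h : Increasing (dir (lt f) t) S) : S ⊆ carrier f := by
  intro x hx
  obtain ⟨y, hy, hxy⟩ := hS.exists_gt x
  have := h x hx y hy hxy
  cases t
  · exact (hf.mem_of_lt _ _ this).2
  · exact (hf.mem_of_lt _ _ this).1

theorem mem_ADS_sol {f g : ℕ → ℕ} (hf : IsLinearOrderCode f) (hg : IsCharFun g)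
    (hS : (toSet g).Infinite) {t : Bool} (h : Increasing (dir (lt f) t) (toSet g)) :
    g ∈ ADS.sol f := by
  have hsub := mem_carrier_of_increasing hf hS h
  refine ⟨hg, hS, ?_⟩
  cases t
  · exact Or.inr ⟨hsub, h⟩
  · exact Or.inl ⟨hsub, h⟩

theorem eq_of_toSet {g g' : ℕ → ℕ} (hg : IsCharFun g) (hg' : IsCharFun g') {x : ℕ}
    (h : x ∈ toSet g' ↔ x ∈ toSet g) : g' x = g x := by
  change g' x = 1 ↔ g x = 1 at h
  rcases hg x with h₁ | h₁ <;> rcases hg' x with h₂ | h₂ <;> simp_all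

theorem exists_continuousReduction (h : WeihrauchReducible (RT1 5) ADS) :
    ∃ (M : (ℕ → Fin 5) → Set ℕ) (r : (ℕ → Fin 5) → ℕ → ℕ → Prop), ContinuousReduction M r := by
  obtain ⟨_, _, ⟨d, rfl⟩, ⟨e, rfl⟩, hred⟩ := h
  let col : (ℕ → Fin 5) → ℕ → ℕ := fun c n => c n
  have hcol : ∀ {m : ℕ} {c c' : ℕ → Fin 5}, Agree m c' c → ∀ j < m, col c' j = col c j :=
    fun hc j hj => congrArg Fin.val (hc j hj)
  choose L hL hdom hsol using fun c : ℕ → Fin 5 => hred (col c) fun n => (c n).2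
  have huse : ∀ c n, ∃ m, ∀ c', Agree m c' c → L c' n = L c n := by
    intro c n
    obtain ⟨m, hm⟩ := d.functional_use (hL c) n
    exact ⟨m, fun c' hc' => hm _ _ (hcol hc') (hL c')⟩
  refine ⟨fun c => carrier (L c), fun c => lt (L c), ?_⟩
  refine ⟨fun c => (hdom c).1.mem_of_lt, fun c => (hdom c).1.trans, fun c => (hdom c).1.total,
    fun c => ?_, fun c x => ?_, fun c x y => ?_, fun c S t hS hinc => ?_⟩
  · obtain ⟨S, hS, h | h⟩ := exists_ascending_or_descending (L c) (hdom c).1 (hdom c).2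
    · exact ⟨S, hS, true, h.2⟩
    · exact ⟨S, hS, false, h.2⟩
  · obtain ⟨m, hm⟩ := huse c (2 * x)
    refine ⟨m, fun c' hc' => ?_⟩
    change L c' _ = 1 ↔ L c _ = 1
    rw [hm c' hc']
  · obtain ⟨m, hm⟩ := huse c (2 * Nat.pair x y + 1)
    refine ⟨m, fun c' hc' => ?_⟩
    change L c' _ = 1 ↔ L c _ = 1
    rw [hm c' hc']
  · obtain ⟨g, hg, rfl⟩ := exists_charFun S
    obtain ⟨k, hk, -, hkinf, -⟩ := hsol c g (mem_ADS_sol (hdom c).1 hg hS hinc)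
    obtain ⟨x, hx⟩ := hkinf.nonempty
    obtain ⟨m, hm⟩ := e.functional_use hk x
    -- One element `x` of the computed solution reveals its color; the bound `x + 1` preserves the
    -- value of the coloring at `x`.
    refine ⟨c x, max m (x + 1), fun c' S' t' hc' hSS' hS' hinc' => ?_⟩
    obtain ⟨g', hg', rfl⟩ := exists_charFun S'
    obtain ⟨k', hk', -, hkinf', hmono⟩ := hsol c' g' (mem_ADS_sol (hdom c').1 hg' hS' hinc')
    have hx' : x ∈ toSet k' := (hm _ _ (join_congr (hcol (hc'.mono (le_max_left _ _)))
      fun j hj => eq_of_toSet hg hg' (hSS' j (lt_max_of_lt_left hj))) hk').trans hx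
    refine hkinf'.mono fun n hn => ?_
    rw [← hc' x (lt_max_of_lt_right x.lt_succ_self)]
    exact Fin.ext (hmono n hn x hx')

theorem RT1_reducible_of_RT1Fin_reducible {k : ℕ} {G : MultiFun}
    (h : WeihrauchReducible RT1Fin G) : WeihrauchReducible (RT1 k) G := by
  obtain ⟨Φ, Ψ, hΦ, hΨ, hred⟩ := h
  exact ⟨Φ, Ψ, hΦ, hΨ, fun f hf => hred f
    ((Set.finite_Iio k).subset (Set.range_subset_iff.mpr hf))⟩

theorem not_RT1_five_reducible_ADS : ¬ WeihrauchReducible (RT1 5) ADS := fun h => by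
  obtain ⟨_, _, H⟩ := exists_continuousReduction h
  exact H.false_of_five_colors

end Weihrauch

theorem mainTheorem10 :
    ¬ Weihrauch.WeihrauchReducible (Weihrauch.RT1 5) Weihrauch.ADS ∧
      ¬ Weihrauch.WeihrauchReducible Weihrauch.RT1Fin Weihrauch.ADS :=
  ⟨Weihrauch.not_RT1_five_reducible_ADS, fun h =>
    Weihrauch.not_RT1_five_reducible_ADS (Weihrauch.RT1_reducible_of_RT1Fin_reducible h)⟩
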